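/- Let $E$ be a nonzero real Banach space with dual $E^*$ and bidual $E^{**}$; for $a\in E$ let $\widehat a\in E^{**}$ be its canonical image. A set $A\subset E\times E^*$ is monotone if $\langle a-b,a^*-b^*\rangle\ge 0$ for all $(a,a^*),(b,b^*)\in A$, and maximally monotone if it is monotone and is not properly contained in another monotone set. Put $$\overline A:=\Big\{(y^*,y^{**})\in E^*\times E^{**}:\ \inf_{(a,a^*)\in A}\langle a^*-y^*,\widehat a-y^{**}\rangle\ge 0\Big\}.$$ Let $\mathcal{CLB}(E)$ be the set of convex functions $h\colon E\to\mathbb R$ that are Lipschitz on every bounded subset of $E$. For such $h$ let $h^*(x^*)=\sup_{x\in E}[\langle x,x^*\rangle-h(x)]$ and $h^{**}(x^{**})=\sup_{x^*\in E^*}[\langle x^*,x^{**}\rangle-h^*(x^*)]$, and let $\mathcal T_{\mathcal{CLB}}(E^{**})$ be the coarsest topology on $E^{**}$ that makes $h^{**}$ continuous for every $h\in\mathcal{CLB}(E)$. Let $w(E^{**},E^*)$ be the weak$^*$ topology of $E^{**}$, and let $\mathcal T_1$ be the coarsest topology on $E^{**}$ that is finer than $w(E^{**},E^*)$ and makes the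 norm $\|\cdot\|\colon E^{**}\to\mathbb R$ continuous. A maximally monotone set $A\subset E\times E^*$ is said to be - of type (ED) if for every $(y^*,y^{**})\in\overline A$ there is a net $(a_\gamma,a_\gamma^*)$ in $A$ such that $a_\gamma^*\to y^*$ in norm and $\widehat{a_\gamma}\to y^{**}$ in $\mathcal T_{\mathcal{CLB}}(E^{**})$; - of dense type if for every $(y^*,y^{**})\in\overline A$ there is a bounded net $(a_\gamma,a_\gamma^*)$ in $A$ such that $a_\gamma^*\to y^*$ in norm and $\widehat{a_\gamma}\to y^{**}$ in $\mathcal T_1$; - of type (D) if for every $(y^*,y^{**})\in\overline A$ there is a bounded net $(a_\gamma,a_\gamma^*)$ in $A$ such that $a_\gamma^*\to y^*$ in norm and $\widehat{a_\gamma}\to y^{**}$ in $w(E^{**},E^*)$; - of type (WD) if for every $(y^*,y^{**})\in\overline A$ there is a bounded net $(a_\gamma,a_\gamma^*)$ in $A$ such that $a_\gamma^*\to y^*$ in norm; - of type (NI) if $\inf_{(a,a^*)\in A}\langle a^*-y^*,\widehat a-y^{**}\rangle\le 0$ for all $(y^*,y^{**})\in E^*\times E^{**}$. Then for every maximally monotone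 set $A\subset E\times E^*$ the following are equivalent: $A$ is of type (ED); $A$ is of dense type; $A$ is of type (D); $A$ is of type (WD); $A$ is of type (NI). -/

import Mathlib

open Filter Topology

noncomputable section

namespace MonotoneClass

universe u

/-! ## Monotone sets and the Gossez extension -/

section Monotone

variable {E : Type u} [NormedAddCommGroup E] [NormedSpace ℝ E]

/-- A subset `A` of `E × E*` is monotone if `⟨a - b, a* - b*⟩ ≥ 0` for all
`(a, a*), (b, b*) ∈ A`. -/
def IsMonotoneSet (A : Set (E × StrongDual ℝ E)) : Prop :=
  ∀ p ∈ A, ∀ q ∈ A, 0 ≤ (p.2 - q.2) (p.1 - q.1)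

/-- A maximally monotone set: monotone, and not properly contained in another monotone set. -/
def IsMaximallyMonotone (A : Set (E × StrongDual ℝ E)) : Prop :=
  Maximal IsMonotoneSet A

/-- The number `inf_{(a, a*) ∈ A} ⟨a* - y*, â - y**⟩`, in `[-∞, ∞]`. -/
def gossezInf (A : Set (E × StrongDual ℝ E))
    (y : StrongDual ℝ E × StrongDual ℝ (StrongDual ℝ E)) : EReal :=
  ⨅ p ∈ A, (((NormedSpace.inclusionInDoubleDual ℝ E p.1 - y.2) (p.2 - y.1) : ℝ) : EReal)

/-- The Gossez extension `Ā ⊆ E* × E**` of `A`. -/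
def gossezExtension (A : Set (E × StrongDual ℝ E)) :
    Set (StrongDual ℝ E × StrongDual ℝ (StrongDual ℝ E)) :=
  {y | 0 ≤ gossezInf A y}

/-- The map `(a, a*) ↦ (a*, â)` from `E × E*` to `E* × E**`. -/
def gossezMap (p : E × StrongDual ℝ E) :
    StrongDual ℝ E × StrongDual ℝ (StrongDual ℝ E) :=
  (p.2, NormedSpace.inclusionInDoubleDual ℝ E p.1)

end Monotone

/-! ## Topologies on the bidual -/

section Topologies

variable {X : Type u} [NormedAddCommGroup X] [NormedSpace ℝ X]

/-- `h : X → ℝ` belongs to `CLB(X)`: it is convex, and Lipschitz on every bounded set. -/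
def IsCLB (h : X → ℝ) : Prop :=
  ConvexOn ℝ Set.univ h ∧
    ∀ s : Set X, Bornology.IsBounded s → ∃ K : NNReal, LipschitzOnWith K h s

/-- The Fenchel conjugate `h*(x*) = sup_{x} (⟨x, x*⟩ - h x)`, in `]-∞, ∞]`. -/
def conj (h : X → ℝ) (x' : StrongDual ℝ X) : EReal :=
  ⨆ x : X, ((x' x - h x : ℝ) : EReal)

/-- The biconjugate `h**(x**) = sup_{x*} (⟨x*, x**⟩ - h*(x*))` on the bidual. It is real valued
if `h` is in `CLB(X)`. -/
def biconj (h : X → ℝ) (x'' : StrongDual ℝ (StrongDual ℝ X)) : EReal :=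
  ⨆ x' : StrongDual ℝ X, ((x'' x' : ℝ) : EReal) - conj h x'

variable (X)

/-- The topology `T_CLB(X**)`: the coarsest topology on `X**` that makes `h**` continuous for
every `h` in `CLB(X)`. -/
@[reducible] def topCLB : TopologicalSpace (StrongDual ℝ (StrongDual ℝ X)) :=
  ⨅ (h : X → ℝ) (_ : IsCLB h), TopologicalSpace.induced (biconj h) inferInstance

/-- The weak-star topology `w(X**, X*)`, as a topology on `X**`. -/
@[reducible] def topWeakStar : TopologicalSpace (StrongDual ℝ (StrongDual ℝ X)) :=
  TopologicalSpace.induced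
    (fun φ : StrongDual ℝ (StrongDual ℝ X) => StrongDual.toWeakDual φ) inferInstance

/-- The topology `T₁`: the upper bound (coarsest common refinement, written `⊓` in Mathlib's order
on topologies) of `w(X**, X*)` and the coarsest topology that makes the norm continuous. -/
@[reducible] def topOne : TopologicalSpace (StrongDual ℝ (StrongDual ℝ X)) :=
  topWeakStar X ⊓
    TopologicalSpace.induced (fun φ : StrongDual ℝ (StrongDual ℝ X) => ‖φ‖) inferInstance

/-- The product on `X* × X**` of the norm topology of `X*` and a topology `τ` on `X**`. -/
@[reducible] def topNormProd (τ : TopologicalSpace (StrongDual ℝ (StrongDual ℝ X))) :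
    TopologicalSpace (StrongDual ℝ X × StrongDual ℝ (StrongDual ℝ X)) :=
  @instTopologicalSpaceProd (StrongDual ℝ X) (StrongDual ℝ (StrongDual ℝ X)) inferInstance τ

end Topologies

/-! ## The classes of maximally monotone sets -/

section Classes

variable {E : Type u} [NormedAddCommGroup E] [NormedSpace ℝ E]

/-- Every point `(y*, y**)` of the Gossez extension of `A` is the limit of a bounded net
`(a*_γ, â_γ)` with `(a_γ, a*_γ) ∈ A`, for the norm topology of `E*` times `τ`. -/
def BoundedNetApprox (τ : TopologicalSpace (StrongDual ℝ (StrongDual ℝ E)))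
    (A : Set (E × StrongDual ℝ E)) : Prop :=
  ∀ y ∈ gossezExtension A,
    ∃ (Γ : Type u) (_ : Preorder Γ) (_ : IsDirected Γ (· ≤ ·)) (_ : Nonempty Γ)
      (a : Γ → E × StrongDual ℝ E),
      (∀ γ, a γ ∈ A) ∧ Bornology.IsBounded (Set.range a) ∧
        Tendsto (fun γ => gossezMap (a γ)) atTop (@nhds _ (topNormProd E τ) y)

/-- `A` is maximally monotone of type (D). -/
def IsTypeD (A : Set (E × StrongDual ℝ E)) : Prop :=
  IsMaximallyMonotone A ∧ BoundedNetApprox (topWeakStar E) A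

/-- `A` is maximally monotone of dense type. -/
def IsDenseType (A : Set (E × StrongDual ℝ E)) : Prop :=
  IsMaximallyMonotone A ∧ BoundedNetApprox (topOne E) A

/-- `A` is maximally monotone of type (NI). -/
def IsTypeNI (A : Set (E × StrongDual ℝ E)) : Prop :=
  IsMaximallyMonotone A ∧
    ∀ y : StrongDual ℝ E × StrongDual ℝ (StrongDual ℝ E), gossezInf A y ≤ 0

/-- `A` is maximally monotone of type (WD). -/
def IsTypeWD (A : Set (E × StrongDual ℝ E)) : Prop :=
  IsMaximallyMonotone A ∧
    ∀ y ∈ gossezExtension A,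
      ∃ (Γ : Type u) (_ : Preorder Γ) (_ : IsDirected Γ (· ≤ ·)) (_ : Nonempty Γ)
        (a : Γ → E × StrongDual ℝ E),
        (∀ γ, a γ ∈ A) ∧ Bornology.IsBounded (Set.range a) ∧
          Tendsto (fun γ => (a γ).2) atTop (𝓝 y.1)

/-- `A` is maximally monotone of type (ED). The net is not required to be bounded. -/
def IsTypeED (A : Set (E × StrongDual ℝ E)) : Prop :=
  IsMaximallyMonotone A ∧
    ∀ y ∈ gossezExtension A,
      ∃ (Γ : Type u) (_ : Preorder Γ) (_ : IsDirected Γ (· ≤ ·)) (_ : Nonempty Γ)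
        (a : Γ → E × StrongDual ℝ E),
        (∀ γ, a γ ∈ A) ∧
          Tendsto (fun γ => gossezMap (a γ)) atTop (@nhds _ (topNormProd E (topCLB E)) y)

end Classes

end MonotoneClass

end

/-! Going down the list is soft. Linear functionals and the norm belong to `CLB`, so `T_CLB` refines
`T₁`, and convergence of the norms makes a tail of the net bounded. Along a bounded net with `a* →
y*` in norm, the pairing in (NI) is at most a constant times `‖a* - y*‖`.

The content is (NI) ⟹ (ED). A nonconvex set `A` cannot be separated from anything, so `A` is
replaced by the convex hull of the graph of its pairing, and two facts are combined. (a)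
`IsTypeNI.exists_mem_near`: a hull point whose second coordinate barely exceeds the pairing is
norm-close to a point of `A`. This is a Brøndsted–Rockafellar type iteration; it uses completeness
and maximality. (b) `IsTypeNI.exists_hull_near`: near a point of the Gossez extension there are hull
points of small excess at which a given convex function is nearly at most its biconjugate. In both,
failure gives by Hahn–Banach an affine minorant of the pairing on `A`, whose slope is a point of `E*
× E**`; (NI) contradicts it. Since (b) bounds convex functions only from above, `IsCLB.exists_gauge`
first encodes the two-sided estimate `|h x - h**(φ)|` in one convex gauge, and gauges can be summed
over finitely many `h`. -/

namespace MonotoneClass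

universe u

/-! ### Hahn–Banach separation by affine functions -/

section Sandwich

variable {V : Type*} [NormedAddCommGroup V] [NormedSpace ℝ V]

/-- Sandwich theorem: an affine function separates a convex set `G ⊆ V × ℝ` from the hypograph of
a continuous concave function `m - K` lying below it. -/
theorem exists_affine_between {G : Set (V × ℝ)} (hG : Convex ℝ G) (hne : G.Nonempty)
    {K : V → ℝ} (hK : ConvexOn ℝ Set.univ K) (hKc : Continuous K) {m : ℝ}
    (h : ∀ p ∈ G, m ≤ p.2 + K p.1) :
    ∃ (z : StrongDual ℝ V) (α : ℝ), (∀ p ∈ G, z p.1 + α ≤ p.2) ∧ ∀ v, m - K v ≤ z v + α := by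
  have hconv : Convex ℝ {p : V × ℝ | p.2 < m - K p.1} := by
    have h1 : ConcaveOn ℝ Set.univ (fun v => m - K v) :=
      (concaveOn_const m convex_univ).sub hK
    simpa using h1.convex_strict_hypograph
  have hopen : IsOpen {p : V × ℝ | p.2 < m - K p.1} :=
    isOpen_lt continuous_snd (continuous_const.sub (hKc.comp continuous_fst))
  have hdisj : Disjoint {p : V × ℝ | p.2 < m - K p.1} G := by
    rw [Set.disjoint_left]
    intro p hp hpG
    have h1 := h p hpG
    simp only [Set.mem_ofPred_eq] at hp
    linarith
  obtain ⟨f, c, hf1, hf2⟩ := geometric_hahn_banach_open hconv hopen hG hdisj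
  set w : StrongDual ℝ V := f.comp (ContinuousLinearMap.inl ℝ V ℝ) with hw
  set γ : ℝ := f (0, 1) with hγ
  have hf : ∀ v s, f (v, s) = w v + γ * s := by
    intro v s
    have h1 : ((v, s) : V × ℝ) = (v, 0) + s • ((0 : V), (1 : ℝ)) := by simp
    rw [h1, map_add, map_smul, smul_eq_mul, mul_comm, hw, hγ]
    simp
  have key : ∀ v s, s < m - K v → w v + γ * s < c := fun v s hs => by
    have := hf1 (v, s) hs
    rwa [hf] at this
  obtain ⟨⟨v₀, r₀⟩, hp₀⟩ := hne
  have h₀ : c ≤ w v₀ + γ * r₀ := by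
    have := hf2 _ hp₀
    rwa [hf] at this
  -- The hypograph contains points over `v₀` below `r₀`, and `f` is smaller there than at `(v₀,
  -- r₀)`; so the separating hyperplane is not vertical.
  have hγpos : 0 < γ := by
    have h2 := key v₀ (min (m - K v₀) r₀ - 1)
      (by have := min_le_left (m - K v₀) r₀; linarith)
    have h3 := min_le_right (m - K v₀) r₀
    by_contra! hneg
    nlinarith
  refine ⟨-(γ⁻¹ • w), γ⁻¹ * c, ?_, ?_⟩
  · rintro ⟨v, r⟩ hp
    have h1 := hf2 _ hp
    rw [hf] at h1
    have h2 : γ⁻¹ * c ≤ γ⁻¹ * (w v + γ * r) := by gcongr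
    rw [mul_add, inv_mul_cancel_left₀ hγpos.ne'] at h2
    simp only [neg_apply, smul_apply, smul_eq_mul]
    linarith
  · intro v
    simp only [neg_apply, smul_apply, smul_eq_mul]
    refine le_of_forall_lt fun s hs => ?_
    have h1 := key v s hs
    have h2 : γ⁻¹ * (w v + γ * s) < γ⁻¹ * c := by gcongr
    rw [mul_add, inv_mul_cancel_left₀ hγpos.ne'] at h2
    linarith

/-- A continuous convex function has a supporting affine function at every point. -/
theorem exists_affine_le_eq {K : V → ℝ} (hK : ConvexOn ℝ Set.univ K) (hKc : Continuous K)
    (v₀ : V) : ∃ (u : StrongDual ℝ V) (β : ℝ), (∀ v, u v - β ≤ K v) ∧ u v₀ - β = K v₀ := by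
  obtain ⟨z, α, h1, h2⟩ := exists_affine_between (G := {(v₀, -K v₀)}) (convex_singleton _)
    (Set.singleton_nonempty _) hK hKc (m := 0) (by simp)
  have h3 := h1 _ rfl
  have h4 := h2 v₀
  refine ⟨-z, α, fun v => ?_, ?_⟩
  · have := h2 v
    simp only [neg_apply]
    linarith
  · simp only [neg_apply] at *
    linarith

/-- The conjugate of half the squared norm is half the squared dual norm. Along each ray the
hypothesis is a nonnegative quadratic in `t`, and its discriminant bounds `f v`. -/
theorem half_sq_norm_le {f : StrongDual ℝ V} {c : ℝ} (h : ∀ v, f v - ‖v‖ ^ 2 / 2 ≤ c) :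
    ‖f‖ ^ 2 / 2 ≤ c := by
  have hc : 0 ≤ c := by simpa using h 0
  have h1 : ‖f‖ ≤ √(2 * c) := by
    refine f.opNorm_le_bound (Real.sqrt_nonneg _) fun v => ?_
    rw [Real.norm_eq_abs]
    apply abs_le_of_sq_le_sq _ (by positivity)
    rw [mul_pow, Real.sq_sqrt (by positivity)]
    have h2 : ∀ t : ℝ, 0 ≤ (‖v‖ ^ 2 / 2) * (t * t) + (-f v) * t + c := fun t => by
      have := h (t • v)
      rw [map_smul, norm_smul, smul_eq_mul, mul_pow, Real.norm_eq_abs, sq_abs] at this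
      linarith
    have := discrim_le_zero h2
    rw [discrim] at this
    linarith
  have h2 : ‖f‖ ^ 2 ≤ √(2 * c) ^ 2 := by gcongr
  rw [Real.sq_sqrt (by positivity)] at h2
  linarith

theorem norm_le_of_apply_le {f : StrongDual ℝ V} {c : ℝ} (hc : 0 ≤ c) (h : ∀ v, f v ≤ c * ‖v‖) :
    ‖f‖ ≤ c :=
  f.opNorm_le_bound hc fun v => abs_le.2
    ⟨by have := h (-v); rw [map_neg, norm_neg] at this; linarith, h v⟩

theorem eq_zero_of_apply_le {f : StrongDual ℝ V} {c : ℝ} (h : ∀ v, f v ≤ c) : f = 0 := by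
  have hc : 0 ≤ c := by simpa using h 0
  ext v
  by_contra hv
  have h1 := h (((c + 1) / f v) • v)
  rw [map_smul, smul_eq_mul, div_mul_cancel₀ _ hv] at h1
  linarith

/-- An affine minorant of `|u - c|` has a slope vanishing on `ker u`, hence a multiple of `u`. Its
value at `φ` is then its value at a point where `u x = c`, or at `0` if `u = 0`. -/
theorem biconj_abs_sub_le_zero {u v : StrongDual ℝ V} {c β : ℝ}
    (φ : StrongDual ℝ (StrongDual ℝ V)) (hc : φ u = c) (h : ∀ x, v x - β ≤ |u x - c|) :
    φ v - β ≤ 0 := by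
  have hker : ∀ x, u x = 0 → v x = 0 := by
    intro x hx
    by_contra hv
    have h1 := h (((|c| + β + 1) / v x) • x)
    rw [map_smul, map_smul, hx, smul_eq_mul, div_mul_cancel₀ _ hv] at h1
    simp at h1
    linarith
  by_cases hu : u = 0
  · have hv : v = 0 := by
      ext x
      exact hker x (by simp [hu])
    subst hu hv
    simp only [map_zero] at hc ⊢
    subst hc
    simpa using h 0
  · obtain ⟨x₁, hx₁⟩ : ∃ x, u x ≠ 0 := by
      by_contra! hcon
      exact hu (by ext x; exact hcon x)
    have hv : v = (v x₁ / u x₁) • u := by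
      ext x
      have h1 := hker (x - (u x / u x₁) • x₁) (by simp [hx₁])
      simp only [map_sub, map_smul, smul_eq_mul] at h1
      simp only [smul_apply, smul_eq_mul]
      field_simp at h1 ⊢
      linarith
    have h2 := h ((c / u x₁) • x₁)
    simp only [map_smul, smul_eq_mul, div_mul_cancel₀ _ hx₁, sub_self, abs_zero] at h2
    rw [hv, map_smul, hc, smul_eq_mul]
    have : v x₁ / u x₁ * c = c / u x₁ * v x₁ := by ring
    linarith

end Sandwich

/-! ### Biconjugates of `CLB` functions -/

section Biconjugate

variable {X : Type u} [NormedAddCommGroup X] [NormedSpace ℝ X]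

/-- `h**(φ) ≤ t`, expressed through the affine minorants of `h`. -/
def BiconjLE (h : X → ℝ) (φ : StrongDual ℝ (StrongDual ℝ X)) (t : ℝ) : Prop :=
  ∀ (v : StrongDual ℝ X) (β : ℝ), (∀ x, v x - β ≤ h x) → φ v - β ≤ t

/-- The sandwich theorem splits an affine minorant of `h₁ + h₂` into a minorant of `h₁` plus a
minorant of `h₂`; continuity of one summand suffices. -/
theorem BiconjLE.add {h₁ h₂ : X → ℝ} {φ : StrongDual ℝ (StrongDual ℝ X)} {t₁ t₂ : ℝ}
    (hc₁ : ConvexOn ℝ Set.univ h₁) (hc₂ : ConvexOn ℝ Set.univ h₂) (hcont₂ : Continuous h₂)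
    (H₁ : BiconjLE h₁ φ t₁) (H₂ : BiconjLE h₂ φ t₂) :
    BiconjLE (fun x => h₁ x + h₂ x) φ (t₁ + t₂) := by
  intro v β hv
  obtain ⟨z, α, hz1, hz2⟩ := exists_affine_between
    (G := {p : X × ℝ | p.1 ∈ Set.univ ∧ h₁ p.1 ≤ p.2}) (K := fun x => h₂ x - v x) (m := -β)
    hc₁.convex_epigraph ⟨(0, h₁ 0), trivial, le_rfl⟩
    (hc₂.sub (v.toLinearMap.concaveOn convex_univ))
    (hcont₂.sub v.continuous) (by
      rintro ⟨x, r⟩ ⟨-, hr⟩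
      have := hv x
      simp only at hr ⊢
      linarith)
  have h1 := H₁ z (-α) fun x => by
    have := hz1 (x, h₁ x) ⟨trivial, le_rfl⟩
    simp only at this
    linarith
  have h2 := H₂ (v - z) (β + α) fun x => by
    have := hz2 x
    simp only [sub_apply]
    linarith
  rw [map_sub] at h2
  linarith

theorem BiconjLE.sum {ι : Type*} (s : Finset ι) {h : ι → X → ℝ}
    {φ : StrongDual ℝ (StrongDual ℝ X)} {t : ι → ℝ}
    (hc : ∀ i ∈ s, ConvexOn ℝ Set.univ (h i)) (hcont : ∀ i ∈ s, Continuous (h i))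
    (H : ∀ i ∈ s, BiconjLE (h i) φ (t i)) :
    ConvexOn ℝ Set.univ (fun x => ∑ i ∈ s, h i x) ∧
      BiconjLE (fun x => ∑ i ∈ s, h i x) φ (∑ i ∈ s, t i) := by
  classical
  induction s using Finset.induction_on with
  | empty =>
    refine ⟨by simpa using convexOn_const (0 : ℝ) convex_univ, fun v β hv => ?_⟩
    simp only [Finset.sum_empty] at hv ⊢
    have hv0 : v = 0 := eq_zero_of_apply_le (c := β) fun x => by linarith [hv x]
    have := hv 0
    subst hv0
    simpa using this
  | insert i s his ih =>
    obtain ⟨ih1, ih2⟩ := ih (fun j hj => hc j (Finset.mem_insert_of_mem hj))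
      (fun j hj => hcont j (Finset.mem_insert_of_mem hj))
      (fun j hj => H j (Finset.mem_insert_of_mem hj))
    have hi := Finset.mem_insert_self i s
    simp only [Finset.sum_insert his]
    refine ⟨(hc i hi).add ih1, (H i hi).add (hc i hi) ih1 ?_ ih2⟩
    exact continuous_finsetSum _ fun j hj => hcont j (Finset.mem_insert_of_mem hj)

theorem biconj_le_iff {h : X → ℝ} {φ : StrongDual ℝ (StrongDual ℝ X)} {t : ℝ} :
    biconj h φ ≤ t ↔ BiconjLE h φ t := by
  have hconj : ∀ (v : StrongDual ℝ X) (β : ℝ), conj h v ≤ β ↔ ∀ x, v x - β ≤ h x := by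
    intro v β
    simp only [conj, iSup_le_iff, EReal.coe_le_coe_iff]
    exact forall_congr' fun x => ⟨fun h => by linarith, fun h => by linarith⟩
  simp only [biconj, iSup_le_iff, BiconjLE]
  refine forall_congr' fun v => ⟨fun H β hβ => ?_, fun H => ?_⟩
  · have h1 : ((φ v : ℝ) : EReal) - (β : ℝ) ≤ t :=
      (EReal.sub_le_sub le_rfl ((hconj v β).2 hβ)).trans H
    exact_mod_cast h1
  · induction hcv : conj h v with
    | bot =>
      have h1 : ((v 0 - h 0 : ℝ) : EReal) ≤ conj h v :=
        le_iSup (fun x : X => ((v x - h x : ℝ) : EReal)) 0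
      rw [hcv] at h1
      exact absurd (le_bot_iff.1 h1) (EReal.coe_ne_bot _)
    | top => simp
    | coe β => exact_mod_cast H β ((hconj v β).1 hcv.le)

theorem le_biconj_of_affine_le {h : X → ℝ} {φ : StrongDual ℝ (StrongDual ℝ X)}
    {v : StrongDual ℝ X} {β : ℝ} (hv : ∀ x, v x - β ≤ h x) :
    ((φ v - β : ℝ) : EReal) ≤ biconj h φ := by
  refine le_of_forall_ge fun c hc => ?_
  induction c with
  | bot =>
    have h1 := (biconj_le_iff (t := φ v - β - 1)).1 (hc.trans bot_le) v β hv
    linarith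
  | top => exact le_top
  | coe t => exact_mod_cast (biconj_le_iff.1 hc) v β hv

theorem IsCLB.continuous {h : X → ℝ} (hh : IsCLB h) : Continuous h := by
  refine continuous_iff_continuousAt.2 fun x => ?_
  obtain ⟨K, hK⟩ := hh.2 _ (Metric.isBounded_ball (x := x) (r := 1))
  exact hK.continuousOn.continuousAt (Metric.ball_mem_nhds x one_pos)

/-- A minorant `v - β` is bounded on the ball of radius `R` by the Lipschitz bound for `h`. This
bounds `R * ‖v‖`, hence `φ v`, in terms of `β`. -/
theorem IsCLB.exists_biconj_eq {h : X → ℝ} (hh : IsCLB h)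
    (φ : StrongDual ℝ (StrongDual ℝ X)) : ∃ t : ℝ, biconj h φ = t := by
  obtain ⟨R, hR, hφR⟩ : ∃ R : ℝ, 0 ≤ R ∧ ∀ v, φ v ≤ R * ‖v‖ :=
    ⟨‖φ‖, φ.opNorm_nonneg, fun v => (le_abs_self _).trans (φ.le_opNorm v)⟩
  obtain ⟨K, hK⟩ := hh.2 _ (Metric.isBounded_closedBall (x := (0 : X)) (r := R))
  have hle : biconj h φ ≤ ((h 0 + K * R : ℝ) : EReal) := by
    rw [biconj_le_iff]
    intro v β hv
    set c := h 0 + K * R + β with hc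
    have h0 : v 0 - β ≤ h 0 := hv 0
    have hc0 : 0 ≤ c := by
      have : 0 ≤ K * R := by positivity
      simp only [map_zero] at h0
      linarith
    have h1 : ∀ x, ‖x‖ ≤ R → v x ≤ c := fun x hx => by
      have h2 := hK.dist_le_mul x (by simpa using hx) 0 (by simpa using hR)
      rw [dist_zero_right, Real.dist_eq] at h2
      have h3 := (abs_le.1 h2).2
      have h4 : (K : ℝ) * ‖x‖ ≤ K * R := by gcongr
      have h5 := hv x
      linarith
    have h2 : R * ‖v‖ ≤ c := by
      have h3 : ‖R • v‖ ≤ c := by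
        refine ContinuousLinearMap.opNorm_le_of_unit_norm hc0 fun x hx => ?_
        have h4 := h1 (R • x) (by simp [norm_smul, hx, abs_of_nonneg hR])
        have h5 := h1 (-(R • x)) (by simp [norm_smul, hx, abs_of_nonneg hR])
        rw [map_neg] at h5
        rw [smul_apply, Real.norm_eq_abs, abs_le]
        rw [map_smul] at h4 h5
        exact ⟨by linarith, h4⟩
      rwa [norm_smul, Real.norm_of_nonneg hR] at h3
    have h3 := hφR v
    linarith
  obtain ⟨u, β, hu, -⟩ := exists_affine_le_eq hh.1 hh.continuous 0
  have hge := le_biconj_of_affine_le (φ := φ) hu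
  induction hb : biconj h φ with
  | bot => rw [hb] at hge; exact absurd (le_bot_iff.1 hge) (EReal.coe_ne_bot _)
  | top => rw [hb] at hle; exact absurd (top_le_iff.1 hle) (EReal.coe_ne_top _)
  | coe t => exact ⟨t, rfl⟩

theorem biconj_inclusion {h : X → ℝ} (hh : IsCLB h) (x : X) :
    biconj h (NormedSpace.inclusionInDoubleDual ℝ X x) = h x := by
  refine le_antisymm (biconj_le_iff.2 fun v β hv => by simpa using hv x) ?_
  obtain ⟨u, β, hu, hx⟩ := exists_affine_le_eq hh.1 hh.continuous x
  have := le_biconj_of_affine_le (φ := NormedSpace.inclusionInDoubleDual ℝ X x) hu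
  rwa [NormedSpace.dual_def, hx] at this

theorem isCLB_dual (v : StrongDual ℝ X) : IsCLB v :=
  ⟨v.toLinearMap.convexOn convex_univ, fun _ _ => ⟨‖v‖₊, v.lipschitz.lipschitzOnWith⟩⟩

theorem isCLB_norm : IsCLB (fun x : X => ‖x‖) :=
  ⟨convexOn_univ_norm, fun _ _ => ⟨1, lipschitzWith_one_norm.lipschitzOnWith⟩⟩

theorem biconj_dual (v : StrongDual ℝ X) (φ : StrongDual ℝ (StrongDual ℝ X)) :
    biconj v φ = ((φ v : ℝ) : EReal) := by
  refine le_antisymm (biconj_le_iff.2 fun w β hw => ?_) ?_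
  · have h1 : w - v = 0 := eq_zero_of_apply_le (c := β) fun x => by
      have := hw x
      simp only [sub_apply]
      linarith
    have h2 := hw 0
    rw [sub_eq_zero.1 h1] at h2 ⊢
    linarith
  · simpa using le_biconj_of_affine_le (h := v) (φ := φ) (v := v) (β := 0) (by simp)

theorem biconj_norm (φ : StrongDual ℝ (StrongDual ℝ X)) :
    biconj (fun x : X => ‖x‖) φ = ((‖φ‖ : ℝ) : EReal) := by
  refine le_antisymm (biconj_le_iff.2 fun v β hv => ?_) ?_
  · have hβ : 0 ≤ β := by have := hv 0; simp at this; linarith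
    have hv1 : ‖v‖ ≤ 1 := norm_le_of_apply_le zero_le_one fun x => by
      rw [one_mul]
      refine le_of_forall_pos_le_add fun ε hε => ?_
      have h1 := hv (((β / ε)) • x)
      rw [map_smul, norm_smul, smul_eq_mul, Real.norm_of_nonneg (by positivity)] at h1
      rcases hβ.eq_or_lt with h0 | h0
      · have := hv x
        linarith
      · have h2 : β / ε * (v x - ‖x‖) ≤ β / ε * ε := by
          rw [div_mul_cancel₀ _ hε.ne']; linarith
        have := le_of_mul_le_mul_left h2 (by positivity)
        linarith
    have h1 := (le_abs_self _).trans (φ.le_opNorm v)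
    have h2 : ‖φ‖ * ‖v‖ ≤ ‖φ‖ * 1 := by gcongr
    linarith
  · obtain ⟨t, ht⟩ := isCLB_norm.exists_biconj_eq φ
    have key : ∀ v : StrongDual ℝ X, ‖v‖ ≤ 1 → φ v ≤ t := fun v hv => by
      have := le_biconj_of_affine_le (φ := φ) (h := fun x : X => ‖x‖) (v := v) (β := 0)
        fun x => by
          have h1 := (le_abs_self _).trans (v.le_of_opNorm_le hv x)
          linarith
      rw [ht, sub_zero] at this
      exact_mod_cast this
    rw [ht]
    have : ‖φ‖ ≤ t := by
      refine ContinuousLinearMap.opNorm_le_of_unit_norm (by simpa using key 0 (by simp))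
        fun v hv => abs_le.2 ⟨?_, key v hv.le⟩
      have := key (-v) (by simp [hv])
      rw [map_neg] at this
      linarith
    exact_mod_cast this

theorem exists_affine_near {h : X → ℝ} {φ : StrongDual ℝ (StrongDual ℝ X)} {t : ℝ}
    (ht : biconj h φ = t) {η : ℝ} (hη : 0 < η) :
    ∃ (u : StrongDual ℝ X) (β : ℝ), (∀ x, u x - β ≤ h x) ∧ t - η < φ u - β := by
  by_contra! hcon
  have h1 : biconj h φ ≤ ((t - η : ℝ) : EReal) := biconj_le_iff.2 hcon
  rw [ht] at h1
  have : t ≤ t - η := by exact_mod_cast h1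
  linarith

/-- A gauge that controls the distance from `h x` to `h**(φ)`. -/
theorem IsCLB.exists_gauge {h : X → ℝ} (hh : IsCLB h) {φ : StrongDual ℝ (StrongDual ℝ X)} {t : ℝ}
    (ht : biconj h φ = t) {η : ℝ} (hη : 0 < η) :
    ∃ g : X → ℝ, ConvexOn ℝ Set.univ g ∧ Continuous g ∧ (∀ x, 0 ≤ g x) ∧ BiconjLE g φ η ∧
      ∀ x, |h x - t| ≤ g x + η := by
  obtain ⟨u, β, hu, hφ⟩ := exists_affine_near ht hη
  have hcu : ConvexOn ℝ Set.univ (fun x => |u x - φ u|) := by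
    have h1 : ConvexOn ℝ Set.univ (fun r : ℝ => |r - φ u|) := by
      simpa [Real.dist_eq] using convexOn_univ_dist (φ u)
    exact h1.comp_linearMap u.toLinearMap
  have hcd : ConvexOn ℝ Set.univ (fun x => h x - u x + β) :=
    (hh.1.sub (u.toLinearMap.concaveOn convex_univ)).add (convexOn_const β convex_univ)
  have hcont : Continuous (fun x => |u x - φ u|) := by fun_prop
  have hh' := hh.continuous
  -- Write `h x - t = (h x - u x + β) + (u x - φ u) + (φ u - β - t)`. The first term is nonnegative
  -- with biconjugate below `η` at `φ`, the absolute value of the second has biconjugate at most `0`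
  -- there, and the third lies in `(-η, 0]`.
  refine ⟨fun x => (h x - u x + β) + |u x - φ u|, hcd.add hcu, by fun_prop, fun x => ?_, ?_, ?_⟩
  · have := hu x
    have := abs_nonneg (u x - φ u)
    linarith
  · have h1 : BiconjLE (fun x => h x - u x + β) φ η := fun v b hv => by
      have := biconj_le_iff.1 ht.le (v + u) (b + β) fun x => by
        have := hv x
        simp only [add_apply]
        linarith
      rw [map_add] at this
      linarith
    have h2 : BiconjLE (fun x => |u x - φ u|) φ 0 := fun v b hv =>
      biconj_abs_sub_le_zero φ rfl hv
    simpa using h1.add hcd hcu hcont h2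
  · intro x
    have h1 := hu x
    have h2 := neg_abs_le (u x - φ u)
    have h3 := le_abs_self (u x - φ u)
    have h4 := biconj_le_iff.1 ht.le u β hu
    rw [abs_le]
    constructor <;> linarith

end Biconjugate

/-! ### Pairing hull and successive approximation -/

section Hull

variable {E : Type u} [NormedAddCommGroup E] [NormedSpace ℝ E]

theorem inclusion_sub_apply (p : E × StrongDual ℝ E)
    (y : StrongDual ℝ E × StrongDual ℝ (StrongDual ℝ E)) :
    (NormedSpace.inclusionInDoubleDual ℝ E p.1 - y.2) (p.2 - y.1) =
      p.2 p.1 - y.1 p.1 - y.2 p.2 + y.2 y.1 := by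
  simp only [sub_apply, map_sub, NormedSpace.dual_def]
  ring

theorem mem_gossezExtension_iff {A : Set (E × StrongDual ℝ E)}
    {y : StrongDual ℝ E × StrongDual ℝ (StrongDual ℝ E)} :
    y ∈ gossezExtension A ↔ ∀ p ∈ A, y.1 p.1 + y.2 p.2 - y.2 y.1 ≤ p.2 p.1 := by
  simp only [gossezExtension, gossezInf, Set.mem_ofPred_eq, le_iInf_iff, inclusion_sub_apply,
    EReal.coe_nonneg]
  exact forall₂_congr fun p _ => ⟨fun h => by linarith, fun h => by linarith⟩

/-- A lower bound over `A` of `⟨a - ·, a* - ·⟩` is nonpositive if `A` satisfies the (NI) inequality. -/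
theorem nonpos_of_gossezInf_le {A : Set (E × StrongDual ℝ E)}
    {y : StrongDual ℝ E × StrongDual ℝ (StrongDual ℝ E)} (hy : gossezInf A y ≤ 0) {m : ℝ}
    (h : ∀ p ∈ A, y.1 p.1 + y.2 p.2 + (m - y.2 y.1) ≤ p.2 p.1) : m ≤ 0 := by
  have h1 : (m : EReal) ≤ gossezInf A y := by
    simp only [gossezInf, le_iInf_iff, inclusion_sub_apply, EReal.coe_le_coe_iff]
    intro p hp
    have := h p hp
    linarith
  exact_mod_cast h1.trans hy

theorem IsTypeNI.nonempty {A : Set (E × StrongDual ℝ E)} (hA : IsTypeNI A) : A.Nonempty := by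
  by_contra hne
  rw [Set.not_nonempty_iff_eq_empty] at hne
  have := nonpos_of_gossezInf_le (hA.2 0) (m := 1) (by simp [hne])
  linarith

/-- The convex hull of the graph of the duality pairing over `A`. -/
def pairingHull (A : Set (E × StrongDual ℝ E)) : Set ((E × StrongDual ℝ E) × ℝ) :=
  convexHull ℝ ((fun p => (p, p.2 p.1)) '' A)

variable {A : Set (E × StrongDual ℝ E)}

theorem mem_pairingHull {p : E × StrongDual ℝ E} (hp : p ∈ A) : (p, p.2 p.1) ∈ pairingHull A :=
  subset_convexHull _ _ ⟨p, hp, rfl⟩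

theorem le_of_mem_pairingHull {ℓ : E × StrongDual ℝ E →ₗ[ℝ] ℝ} {c : ℝ}
    (h : ∀ p ∈ A, ℓ p + c ≤ p.2 p.1) {p : (E × StrongDual ℝ E) × ℝ} (hp : p ∈ pairingHull A) :
    ℓ p.1 + c ≤ p.2 := by
  have hconv : Convex ℝ {p : (E × StrongDual ℝ E) × ℝ | ℓ p.1 + c ≤ p.2} := by
    simpa using ((ℓ.convexOn convex_univ).add (convexOn_const c convex_univ)).convex_epigraph
  exact convexHull_min (by rintro _ ⟨p, hp, rfl⟩; exact h p hp) hconv hp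

/-- The functional `⟨x, b*⟩ + ⟨b, x*⟩` on `E × E*`. -/
noncomputable def pairingWith (b : E × StrongDual ℝ E) : E × StrongDual ℝ E →L[ℝ] ℝ :=
  b.2.coprod (NormedSpace.inclusionInDoubleDual ℝ E b.1)

theorem pairingWith_apply (b x : E × StrongDual ℝ E) : pairingWith b x = b.2 x.1 + x.2 b.1 := by
  simp [pairingWith]

theorem pairingWith_comm (b x : E × StrongDual ℝ E) : pairingWith b x = pairingWith x b := by
  simp only [pairingWith_apply]
  ring

/-- Monotonicity in polarised form is affine in each argument separately, so it passes to the hull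
one argument at a time. With `p = q` it says that the excess `p.2 - p.1.2 p.1.1` is nonnegative. -/
theorem IsMonotoneSet.pairing_le (hA : IsMonotoneSet A) {p q : (E × StrongDual ℝ E) × ℝ}
    (hp : p ∈ pairingHull A) (hq : q ∈ pairingHull A) :
    p.1.2 q.1.1 + q.1.2 p.1.1 ≤ p.2 + q.2 := by
  have h1 : ∀ a ∈ A, ∀ q ∈ pairingHull A, pairingWith a q.1 + -(a.2 a.1) ≤ q.2 := by
    intro a ha q hq
    refine le_of_mem_pairingHull (ℓ := (pairingWith a).toLinearMap) (fun b hb => ?_) hq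
    have := hA a ha b hb
    simp only [sub_apply, map_sub] at this
    simp only [ContinuousLinearMap.coe_coe, pairingWith_apply]
    linarith
  have h2 := le_of_mem_pairingHull (ℓ := (pairingWith q.1).toLinearMap) (c := -q.2)
    (fun a ha => by
      have := h1 a ha q hq
      rw [pairingWith_comm] at this
      rw [ContinuousLinearMap.coe_coe]
      linarith) hp
  simp only [ContinuousLinearMap.coe_coe, pairingWith_apply] at h2
  linarith

theorem IsMaximallyMonotone.mem_of_forall (hA : IsMaximallyMonotone A) {p : E × StrongDual ℝ E}
    (h : ∀ a ∈ A, 0 ≤ (p.2 - a.2) (p.1 - a.1)) : p ∈ A := by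
  refine hA.2 (y := insert p A) ?_ (Set.subset_insert p A) (Set.mem_insert p A)
  rintro a (rfl | ha) b (rfl | hb)
  · simp
  · exact h b hb
  · have := h a ha
    simp only [sub_apply, map_sub] at this ⊢
    linarith
  · exact hA.1 a ha b hb

theorem dual_prod_apply (z : StrongDual ℝ (E × StrongDual ℝ E)) (x : E) (x' : StrongDual ℝ E) :
    z (x, x') = z.comp (ContinuousLinearMap.inl ℝ E (StrongDual ℝ E)) x +
      z.comp (ContinuousLinearMap.inr ℝ E (StrongDual ℝ E)) x' := by
  simp [← map_add]

theorem convexOn_half_sq_norm_sub {V : Type*} [NormedAddCommGroup V] [NormedSpace ℝ V] (v₀ : V) :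
    ConvexOn ℝ Set.univ (fun v => ‖v - v₀‖ ^ 2 / 2) := by
  have h1 : ConvexOn ℝ Set.univ (fun v => ‖v - v₀‖) := by
    simpa [dist_eq_norm] using convexOn_univ_dist v₀
  have h2 := (h1.pow (fun _ _ => norm_nonneg _) 2).smul (c := (2 : ℝ)⁻¹) (by norm_num)
  refine h2.congr fun v _ => ?_
  simp only [Pi.pow_apply, smul_eq_mul]
  ring

/-- Points of the hull almost minimise the (nonnegative) sum of the translated pairing and the
half squared norm. -/
theorem IsTypeNI.exists_near (hA : IsTypeNI A) (b : E × StrongDual ℝ E) {ε : ℝ} (hε : 0 < ε) :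
    ∃ p ∈ pairingHull A, p.2 - pairingWith b p.1 + b.2 b.1 +
      (‖p.1.1 - b.1‖ ^ 2 / 2 + ‖p.1.2 - b.2‖ ^ 2 / 2) < ε := by
  by_contra! hcon
  obtain ⟨a₀, ha₀⟩ := hA.nonempty
  have hK1 : ConvexOn ℝ Set.univ (fun c : E × StrongDual ℝ E => ‖c.1 - b.1‖ ^ 2 / 2) :=
    (convexOn_half_sq_norm_sub b.1).comp_linearMap (LinearMap.fst ℝ E (StrongDual ℝ E))
  have hK2 : ConvexOn ℝ Set.univ (fun c : E × StrongDual ℝ E => ‖c.2 - b.2‖ ^ 2 / 2) :=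
    (convexOn_half_sq_norm_sub b.2).comp_linearMap (LinearMap.snd ℝ E (StrongDual ℝ E))
  obtain ⟨z, α, hz1, hz2⟩ := exists_affine_between (G := pairingHull A) (convex_convexHull _ _)
    ⟨_, mem_pairingHull ha₀⟩ (m := ε)
    (K := fun c => (‖c.1 - b.1‖ ^ 2 / 2 + ‖c.2 - b.2‖ ^ 2 / 2) +
      (b.2 b.1 - pairingWith b c))
    ((hK1.add hK2).add ((convexOn_const _ convex_univ).sub
      ((pairingWith b).toLinearMap.concaveOn convex_univ)))
    (by fun_prop)
    (fun p hp => by have := hcon p hp; linarith)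
  set z₁ := z.comp (ContinuousLinearMap.inl ℝ E (StrongDual ℝ E)) with hz₁
  set z₂ := z.comp (ContinuousLinearMap.inr ℝ E (StrongDual ℝ E)) with hz₂
  have hz : ∀ x x', z (x, x') = z₁ x + z₂ x' := dual_prod_apply z
  -- The separating slope is itself a point of `E* × E**`, so (NI) applies to it.
  have hNI : z₂ z₁ + α ≤ 0 := nonpos_of_gossezInf_le (hA.2 (z₁, z₂)) fun p hp => by
    have := hz1 _ (mem_pairingHull hp)
    rw [hz] at this
    simp only
    linarith
  set w₁ := b.2 - z₁ with hw₁
  set w₂ := NormedSpace.inclusionInDoubleDual ℝ E b.1 - z₂ with hw₂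
  set c := z₁ b.1 + z₂ b.2 + α - b.2 b.1 - ε with hc
  have hd : ∀ d d', w₁ d - ‖d‖ ^ 2 / 2 + (w₂ d' - ‖d'‖ ^ 2 / 2) ≤ c := by
    intro d d'
    have := hz2 (b.1 + d, b.2 + d')
    rw [hz, pairingWith_apply] at this
    simp only [add_sub_cancel_left, map_add, add_apply] at this
    simp only [hw₁, hw₂, sub_apply, NormedSpace.dual_def]
    linarith
  have hd1 : ∀ d', w₂ d' - ‖d'‖ ^ 2 / 2 ≤ c - ‖w₁‖ ^ 2 / 2 := fun d' => by
    have := half_sq_norm_le (f := w₁) (c := c - (w₂ d' - ‖d'‖ ^ 2 / 2)) fun d => by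
      have := hd d d'
      linarith
    linarith
  have hd2 := half_sq_norm_le hd1
  have h1 : -(w₂ w₁) ≤ ‖w₂‖ * ‖w₁‖ := (neg_le_abs _).trans (w₂.le_opNorm w₁)
  have h2 : w₂ w₁ = b.2 b.1 - z₁ b.1 - z₂ b.2 + z₂ z₁ := by
    simp only [hw₁, hw₂, sub_apply, map_sub, NormedSpace.dual_def]
    ring
  -- Here `c = -(w₂ w₁) + (z₂ z₁ + α) - ε ≤ ‖w₂‖ * ‖w₁‖ - ε`, while `hd2` gives `‖w₁‖ ^ 2 / 2 + ‖w₂‖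
  -- ^ 2 / 2 ≤ c`.
  nlinarith [sq_nonneg (‖w₂‖ - ‖w₁‖)]

/-- Successive approximation step: from a point of the hull close to the pairing one moves a short
way to a point even closer. -/
theorem IsTypeNI.exists_step (hA : IsTypeNI A) {δ ε : ℝ} (hε : 0 < ε)
    {p : (E × StrongDual ℝ E) × ℝ} (hp : p ∈ pairingHull A) (hδ : p.2 - p.1.2 p.1.1 ≤ δ) :
    ∃ p' ∈ pairingHull A, p'.2 - p'.1.2 p'.1.1 ≤ ε ∧ ‖p'.1 - p.1‖ ^ 2 / 2 ≤ δ + ε := by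
  obtain ⟨p', hp', h⟩ := hA.exists_near p.1 hε
  refine ⟨p', hp', ?_, ?_⟩
  · have h1 : -((p'.1.2 - p.1.2) (p'.1.1 - p.1.1)) ≤ ‖p'.1.2 - p.1.2‖ * ‖p'.1.1 - p.1.1‖ :=
      (neg_le_abs _).trans ((p'.1.2 - p.1.2).le_opNorm _)
    simp only [sub_apply, map_sub] at h1
    rw [pairingWith_apply] at h
    nlinarith [sq_nonneg (‖p'.1.2 - p.1.2‖ - ‖p'.1.1 - p.1.1‖)]
  · have h1 := hA.1.1.pairing_le hp hp'
    rw [pairingWith_apply] at h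
    have h2 : ‖p'.1 - p.1‖ ^ 2 ≤ ‖p'.1.1 - p.1.1‖ ^ 2 + ‖p'.1.2 - p.1.2‖ ^ 2 := by
      rw [Prod.norm_def]
      rcases max_choice ‖(p'.1 - p.1).1‖ ‖(p'.1 - p.1).2‖ with h3 | h3 <;> rw [h3]
      · exact le_add_of_nonneg_right (sq_nonneg _)
      · exact le_add_of_nonneg_left (sq_nonneg _)
    linarith

/-- Iterating `IsTypeNI.exists_step` with geometrically decreasing excess gives a Cauchy sequence.
Its limit is monotonically related to all of `A`, since the excess tends to `0`, and so lies in `A`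
by maximality. -/
theorem IsTypeNI.exists_mem_near [CompleteSpace E] (hA : IsTypeNI A) {η : ℝ} (hη : 0 < η)
    {p : (E × StrongDual ℝ E) × ℝ} (hp : p ∈ pairingHull A)
    (hpη : p.2 - p.1.2 p.1.1 ≤ (η / 8) ^ 2) : ∃ a ∈ A, ‖a - p.1‖ ≤ η := by
  -- Each squared step is at most `2 * (δ n + δ (n + 1)) ≤ 4 * δ n = (η / 4 / 2 ^ n) ^ 2`, so the
  -- total displacement is at most `η / 2`.
  set δ : ℕ → ℝ := fun n => (η / 8 / 2 ^ n) ^ 2 with hδ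
  have hδpos : ∀ n, 0 < δ n := fun n => by positivity
  have hstep : ∀ (n : ℕ) (s : {p : (E × StrongDual ℝ E) × ℝ // p ∈ pairingHull A}),
      ∃ s' : {p : (E × StrongDual ℝ E) × ℝ // p ∈ pairingHull A},
        s.1.2 - s.1.1.2 s.1.1.1 ≤ δ n →
          s'.1.2 - s'.1.1.2 s'.1.1.1 ≤ δ (n + 1) ∧
            ‖s'.1.1 - s.1.1‖ ^ 2 / 2 ≤ δ n + δ (n + 1) := fun n s => by
    by_cases hs : s.1.2 - s.1.1.2 s.1.1.1 ≤ δ n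
    · obtain ⟨p', hp', h1⟩ := hA.exists_step (hδpos (n + 1)) s.2 hs
      exact ⟨⟨p', hp'⟩, fun _ => h1⟩
    · exact ⟨s, fun h => absurd h hs⟩
  choose next hnext using hstep
  set s : ℕ → {p : (E × StrongDual ℝ E) × ℝ // p ∈ pairingHull A} :=
    fun n => Nat.rec ⟨p, hp⟩ next n with hs
  have hs1 : ∀ n, (s n).1.2 - (s n).1.1.2 (s n).1.1.1 ≤ δ n := by
    intro n
    induction n with
    | zero => simpa [hs, hδ] using hpη
    | succ n ih => exact (hnext n (s n) ih).1
  have hs2 : ∀ n, dist (s n).1.1 (s (n + 1)).1.1 ≤ η / 2 / 2 / 2 ^ n := by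
    intro n
    have h1 : ‖(s (n + 1)).1.1 - (s n).1.1‖ ^ 2 / 2 ≤ δ n + δ (n + 1) :=
      (hnext n (s n) (hs1 n)).2
    have h2 : δ (n + 1) ≤ δ n := by
      simp only [hδ]
      gcongr
      · norm_num
      · simp
    rw [dist_comm, dist_eq_norm]
    apply le_of_sq_le_sq _ (by positivity)
    have h3 : (η / 2 / 2 / 2 ^ n) ^ 2 = 4 * δ n := by
      simp only [hδ]
      ring
    rw [h3]
    linarith
  obtain ⟨a, ha⟩ := cauchySeq_tendsto_of_complete (cauchySeq_of_le_geometric_two hs2)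
  have hdist := dist_le_of_le_geometric_two_of_tendsto₀ hs2 ha
  refine ⟨a, hA.1.mem_of_forall fun b hb => ?_, ?_⟩
  · have hlim : Tendsto (fun n => δ n) atTop (𝓝 0) := by
      have h1 : Tendsto (fun n : ℕ => η / 8 / 2 ^ n) atTop (𝓝 0) :=
        tendsto_const_nhds.div_atTop (tendsto_pow_atTop_atTop_of_one_lt one_lt_two)
      simpa using h1.pow 2
    have hcont : Continuous fun c : E × StrongDual ℝ E => (c.2 - b.2) (c.1 - b.1) := by fun_prop
    have hl := (hcont.tendsto a).comp ha
    have hl2 := hl.add hlim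
    rw [add_zero] at hl2
    refine ge_of_tendsto' hl2 fun n => ?_
    have h1 := hA.1.1.pairing_le (s n).2 (mem_pairingHull hb)
    have h2 := hs1 n
    simp only [Function.comp_apply, sub_apply, map_sub]
    linarith
  · rw [← dist_eq_norm, dist_comm]
    refine hdist.trans' (le_of_eq ?_) |>.trans ?_ <;> simp [hs]
    linarith

/-! ### Approximating points of the Gossez extension -/

/-- At a point of the Gossez extension of a set of type (NI) the biconjugate of the pairing is at
most the pairing. -/
theorem IsTypeNI.biconj_pairing_le (hA : IsTypeNI A)
    {y : StrongDual ℝ E × StrongDual ℝ (StrongDual ℝ E)} (hy : y ∈ gossezExtension A)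
    {z₁ : StrongDual ℝ E} {z₂ : StrongDual ℝ (StrongDual ℝ E)} {α : ℝ}
    (hz : ∀ p ∈ A, z₁ p.1 + z₂ p.2 + α ≤ p.2 p.1) : y.2 z₁ + z₂ y.1 + α ≤ y.2 y.1 := by
  rw [mem_gossezExtension_iff] at hy
  set Q := (z₂ - y.2) (z₁ - y.1) with hQ
  -- Both `y` and `z` give affine minorants of the pairing on `A`. (NI) at the slope of their convex
  -- combination, divided by `t`, leaves an error `t * Q` that vanishes as `t → 0`.
  have key : ∀ t : ℝ, 0 < t → t ≤ 1 → y.2 z₁ + z₂ y.1 + α - y.2 y.1 + t * Q ≤ 0 := by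
    intro t ht ht1
    have h1 := nonpos_of_gossezInf_le (hA.2 (y.1 + t • (z₁ - y.1), y.2 + t • (z₂ - y.2)))
      (m := t * (y.2 z₁ + z₂ y.1 + α - y.2 y.1 + t * Q)) fun p hp => by
        have h2 := mul_le_mul_of_nonneg_left (hz p hp) ht.le
        have h3 := mul_le_mul_of_nonneg_left (hy p hp) (sub_nonneg.2 ht1)
        simp only [hQ, add_apply, smul_apply, sub_apply, map_add, map_sub, map_smul, smul_eq_mul]
        nlinarith
    exact nonpos_of_mul_nonpos_right h1 ht
  have hlim : Tendsto (fun t : ℝ => y.2 z₁ + z₂ y.1 + α - y.2 y.1 + t * Q) (𝓝[>] 0)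
      (𝓝 (y.2 z₁ + z₂ y.1 + α - y.2 y.1 + 0 * Q)) :=
    (Continuous.tendsto (by fun_prop) 0).mono_left nhdsWithin_le_nhds
  have := le_of_tendsto hlim (by
    filter_upwards [Ioc_mem_nhdsGT zero_lt_one] with t ht using key t ht.1 ht.2)
  linarith

theorem IsTypeNI.exists_hull_near (hA : IsTypeNI A)
    {y : StrongDual ℝ E × StrongDual ℝ (StrongDual ℝ E)} (hy : y ∈ gossezExtension A)
    {g : E → ℝ} (hg : ConvexOn ℝ Set.univ g) (hgc : Continuous g) {t : ℝ}
    (hgt : BiconjLE g y.2 t) {ε : ℝ} (hε : 0 < ε) :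
    ∃ p ∈ pairingHull A, g p.1.1 + ‖p.1.2 - y.1‖ +
      (p.2 - (y.1 p.1.1 + y.2 p.1.2) + y.2 y.1) < t + ε := by
  by_contra! hcon
  obtain ⟨a₀, ha₀⟩ := hA.nonempty
  have hK1 : ConvexOn ℝ Set.univ (fun c : E × StrongDual ℝ E => g c.1) :=
    hg.comp_linearMap (LinearMap.fst ℝ E (StrongDual ℝ E))
  have hK2 : ConvexOn ℝ Set.univ (fun c : E × StrongDual ℝ E => ‖c.2 - y.1‖) := by
    have h1 : ConvexOn ℝ Set.univ (fun v => ‖v - y.1‖) := by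
      simpa [dist_eq_norm] using convexOn_univ_dist y.1
    exact h1.comp_linearMap (LinearMap.snd ℝ E (StrongDual ℝ E))
  obtain ⟨z, α, hz1, hz2⟩ := exists_affine_between (G := pairingHull A) (convex_convexHull _ _)
    ⟨_, mem_pairingHull ha₀⟩ (m := t + ε)
    (K := fun c => (g c.1 + ‖c.2 - y.1‖) + (y.2 y.1 - y.1.coprod y.2 c))
    ((hK1.add hK2).add ((convexOn_const _ convex_univ).sub
      ((y.1.coprod y.2).toLinearMap.concaveOn convex_univ)))
    (by fun_prop)
    (fun p hp => by
      have := hcon p hp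
      simp only [ContinuousLinearMap.coprod_apply]
      linarith)
  set z₁ := z.comp (ContinuousLinearMap.inl ℝ E (StrongDual ℝ E)) with hz₁
  set z₂ := z.comp (ContinuousLinearMap.inr ℝ E (StrongDual ℝ E)) with hz₂
  have hz : ∀ x x', z (x, x') = z₁ x + z₂ x' := dual_prod_apply z
  have h1 := hA.biconj_pairing_le hy (z₁ := z₁) (z₂ := z₂) (α := α) fun p hp => by
    have := hz1 _ (mem_pairingHull hp)
    rwa [hz] at this
  -- At `x' = y.1` the norm term vanishes, leaving an affine minorant of `g` alone.
  have h2 := hgt (y.1 - z₁) (z₂ y.1 + α - t - ε) fun x => by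
    have := hz2 (x, y.1)
    rw [hz] at this
    simp only [ContinuousLinearMap.coprod_apply, sub_self, norm_zero] at this
    simp only [sub_apply]
    linarith
  rw [map_sub] at h2
  linarith

/-- A point of the Gossez extension of a set of type (NI) is approximated by points of the set,
simultaneously for finitely many functions of `CLB`. -/
theorem IsTypeNI.exists_mem_approx [CompleteSpace E] (hA : IsTypeNI A)
    {y : StrongDual ℝ E × StrongDual ℝ (StrongDual ℝ E)} (hy : y ∈ gossezExtension A)
    (S : Finset {h : E → ℝ // IsCLB h}) {ε : ℝ} (hε : 0 < ε) :
    ∃ a ∈ A, ‖a.2 - y.1‖ < ε ∧ ∀ h ∈ S, |h.1 a.1 - (biconj h.1 y.2).toReal| < ε := by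
  classical
  -- Adding the norm to the family bounds `p.1.1`. This controls the excess of `p` and keeps `p.1.1`
  -- and `a.1` in one ball, of radius `‖y.2‖ + 2`, where the Lipschitz constants are fixed.
  set N : {h : E → ℝ // IsCLB h} := ⟨_, isCLB_norm⟩ with hN
  set S' := insert N S with hS'
  set H : {h : E → ℝ // IsCLB h} → ℝ := fun h => (biconj h.1 y.2).toReal with hH
  have hbi : ∀ h : {h : E → ℝ // IsCLB h}, biconj h.1 y.2 = H h := fun h => by
    obtain ⟨t, ht⟩ := h.2.exists_biconj_eq y.2
    simp [hH, ht]
  have hHN : H N = ‖y.2‖ := by simp [hH, hN, biconj_norm]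
  have hLip : ∀ h : {h : E → ℝ // IsCLB h}, ∃ K : NNReal,
      LipschitzOnWith K h.1 (Metric.closedBall 0 (‖y.2‖ + 2)) :=
    fun h => h.2.2 _ Metric.isBounded_closedBall
  choose K hK using hLip
  obtain ⟨η, hη0, hη1, hηε, hηK⟩ : ∃ η : ℝ, 0 < η ∧ η ≤ 1 ∧ η < ε / 2 ∧
      ∀ h ∈ S, K h * η < ε / 2 := by
    have h0 : ∀ᶠ η : ℝ in 𝓝[>] 0, ∀ h ∈ S, K h * η < ε / 2 := by
      rw [eventually_all_finset]
      intro h _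
      have h1 : Tendsto (fun η : ℝ => (K h : ℝ) * η) (𝓝[>] 0) (𝓝 (K h * 0)) :=
        (Continuous.tendsto (by fun_prop) 0).mono_left nhdsWithin_le_nhds
      rw [mul_zero] at h1
      exact h1.eventually_lt_const (by positivity)
    have h2 : ∀ᶠ η : ℝ in 𝓝[>] 0, η ∈ Set.Ioo 0 (min 1 (ε / 2)) :=
      Ioo_mem_nhdsGT (by positivity)
    obtain ⟨η, hη, hη'⟩ := (h0.and h2).exists
    exact ⟨η, hη'.1, (hη'.2.trans_le (min_le_left _ _)).le,
      hη'.2.trans_le (min_le_right _ _), hη⟩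
  obtain ⟨ρ, hρ0, hρ1, hρε, hρη⟩ : ∃ ρ : ℝ, 0 < ρ ∧ ρ ≤ 1 / 2 ∧ ρ < ε / 4 ∧
      ρ * (2 * ‖y.2‖ + 2) ≤ (η / 8) ^ 2 := by
    refine ⟨min (1 / 2) (min (ε / 8) ((η / 8) ^ 2 / (2 * ‖y.2‖ + 2))), by positivity,
      min_le_left _ _, ?_, ?_⟩
    · have := (min_le_right (1 / 2) _).trans (min_le_left (ε / 8) ((η / 8) ^ 2 / (2 * ‖y.2‖ + 2)))
      linarith
    · rw [← le_div_iff₀ (by positivity)]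
      exact (min_le_right _ _).trans (min_le_right _ _)
  obtain ⟨n, hn, hn0⟩ : ∃ n : ℝ, (S'.card : ℝ) = n ∧ 0 ≤ n := ⟨_, rfl, Nat.cast_nonneg _⟩
  -- The total gauge error `n * θ` is at most `ρ / 2`, even for `n = 0`; the other `ρ / 2` is the
  -- slack in `exists_hull_near`.
  set θ := ρ / (2 * (n + 1)) with hθ
  have hθ0 : 0 < θ := by positivity
  have hθρ : θ ≤ ρ := div_le_self hρ0.le (by linarith)
  choose g hg1 hg2 hg3 hg4 hg5 using
    fun h : {h : E → ℝ // IsCLB h} => h.2.exists_gauge (hbi h) hθ0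
  obtain ⟨hG1, hG2⟩ := BiconjLE.sum S' (fun h _ => hg1 h) (fun h _ => hg2 h) (fun h _ => hg4 h)
  obtain ⟨p, hp, hlt⟩ := hA.exists_hull_near hy hG1 (continuous_finsetSum _ fun h _ => hg2 h)
    hG2 (ε := ρ / 2) (by positivity)
  have hsum : ∑ _i ∈ S', θ + ρ / 2 ≤ ρ := by
    have h1 : n * θ ≤ ρ / 2 := by
      rw [hθ, mul_div_assoc', div_le_div_iff₀ (by positivity) (by norm_num)]
      nlinarith
    rw [Finset.sum_const, nsmul_eq_mul, hn]
    linarith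
  have hpy : 0 ≤ p.2 - (y.1 p.1.1 + y.2 p.1.2) + y.2 y.1 := by
    have := le_of_mem_pairingHull (ℓ := (y.1.coprod y.2).toLinearMap) (c := -y.2 y.1)
      (fun a ha => by
        have := mem_gossezExtension_iff.1 hy a ha
        simp only [ContinuousLinearMap.coe_coe, ContinuousLinearMap.coprod_apply]
        linarith) hp
    simp only [ContinuousLinearMap.coe_coe, ContinuousLinearMap.coprod_apply] at this
    linarith
  have hp0 := norm_nonneg (p.1.2 - y.1)
  have hgsum : 0 ≤ ∑ h ∈ S', g h p.1.1 := Finset.sum_nonneg fun h _ => hg3 h _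
  have hclose : ∀ h ∈ S', |h.1 p.1.1 - H h| ≤ 2 * ρ := fun h hh => by
    have h1 := Finset.single_le_sum (f := fun h => g h p.1.1) (fun h _ => hg3 h _) hh
    have h2 := hg5 h p.1.1
    linarith
  have hpn : ‖p.1.1‖ ≤ ‖y.2‖ + 1 := by
    have h1 := (le_abs_self _).trans (hclose N (Finset.mem_insert_self _ _))
    rw [hHN] at h1
    simp only [hN] at h1
    linarith
  have hq : p.2 - p.1.2 p.1.1 ≤ (η / 8) ^ 2 := by
    have h1 : -((p.1.2 - y.1) p.1.1) ≤ ‖p.1.2 - y.1‖ * ‖p.1.1‖ :=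
      (neg_le_abs _).trans ((p.1.2 - y.1).le_opNorm _)
    have h2 : y.2 (p.1.2 - y.1) ≤ ‖y.2‖ * ‖p.1.2 - y.1‖ :=
      (le_abs_self _).trans (y.2.le_opNorm _)
    have h3 : ‖p.1.2 - y.1‖ ≤ ρ - (p.2 - (y.1 p.1.1 + y.2 p.1.2) + y.2 y.1) := by linarith
    have h4 := norm_nonneg p.1.1
    have h5 := norm_nonneg y.2
    rw [sub_apply] at h1
    rw [map_sub] at h2
    have h6 : ‖p.1.2 - y.1‖ * ‖p.1.1‖ ≤ ‖p.1.2 - y.1‖ * (‖y.2‖ + 1) := by gcongr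
    have h7 : ‖p.1.2 - y.1‖ * (2 * ‖y.2‖ + 1) ≤ ρ * (2 * ‖y.2‖ + 1) := by
      gcongr
      linarith
    nlinarith
  obtain ⟨a, ha, hap⟩ := hA.exists_mem_near hη0 hp hq
  have hap1 : ‖a.1 - p.1.1‖ ≤ η := (norm_fst_le (a - p.1)).trans hap
  have hap2 : ‖a.2 - p.1.2‖ ≤ η := (norm_snd_le (a - p.1)).trans hap
  refine ⟨a, ha, ?_, fun h hh => ?_⟩
  · have := norm_sub_le_norm_sub_add_norm_sub a.2 p.1.2 y.1
    linarith
  · have h1 : ‖a.1‖ ≤ ‖y.2‖ + 2 := by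
      have := norm_le_norm_add_norm_sub' a.1 p.1.1
      linarith
    have h2 := (hK h).dist_le_mul a.1 (by simpa using h1) p.1.1
      (by simp only [mem_closedBall_zero_iff]; linarith)
    rw [dist_eq_norm, dist_eq_norm, Real.norm_eq_abs] at h2
    have h3 : (K h : ℝ) * ‖a.1 - p.1.1‖ ≤ K h * η := by gcongr
    have h4 := hclose h (Finset.mem_insert_of_mem hh)
    have h5 := abs_sub_le (h.1 a.1) (h.1 p.1.1) (H h)
    have h6 := hηK h hh
    simp only [hH] at h4 h5
    linarith

end Hull

/-! ### Topologies on the bidual and the cycle of implications -/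

section Topology

variable {E : Type u} [NormedAddCommGroup E] [NormedSpace ℝ E]

theorem tendsto_topNormProd_iff {Γ : Type*} {l : Filter Γ}
    {τ : TopologicalSpace (StrongDual ℝ (StrongDual ℝ E))} {a : Γ → E × StrongDual ℝ E}
    {y : StrongDual ℝ E × StrongDual ℝ (StrongDual ℝ E)} :
    Tendsto (fun γ => gossezMap (a γ)) l (@nhds _ (topNormProd E τ) y) ↔
      Tendsto (fun γ => (a γ).2) l (𝓝 y.1) ∧
        Tendsto (fun γ => NormedSpace.inclusionInDoubleDual ℝ E (a γ).1) l (@nhds _ τ y.2) :=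
  @Prod.tendsto_iff _ _ _ τ _ _ _ _

theorem tendsto_topCLB_iff {Γ : Type*} {l : Filter Γ}
    {f : Γ → StrongDual ℝ (StrongDual ℝ E)} {φ : StrongDual ℝ (StrongDual ℝ E)} :
    Tendsto f l (@nhds _ (topCLB E) φ) ↔
      ∀ h : E → ℝ, IsCLB h → Tendsto (fun γ => biconj h (f γ)) l (𝓝 (biconj h φ)) := by
  simp only [nhds_iInf, tendsto_iInf, nhds_induced, tendsto_comap_iff]
  rfl

theorem tendsto_topWeakStar_iff {Γ : Type*} {l : Filter Γ}
    {f : Γ → StrongDual ℝ (StrongDual ℝ E)} {φ : StrongDual ℝ (StrongDual ℝ E)} :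
    Tendsto f l (@nhds _ (topWeakStar E) φ) ↔
      ∀ v : StrongDual ℝ E, Tendsto (fun γ => f γ v) l (𝓝 (φ v)) := by
  rw [topWeakStar, nhds_induced, tendsto_comap_iff,
    tendsto_iff_forall_eval_tendsto_topDualPairing]
  rfl

theorem tendsto_topOne_iff {Γ : Type*} {l : Filter Γ}
    {f : Γ → StrongDual ℝ (StrongDual ℝ E)} {φ : StrongDual ℝ (StrongDual ℝ E)} :
    Tendsto f l (@nhds _ (topOne E) φ) ↔
      Tendsto f l (@nhds _ (topWeakStar E) φ) ∧
        Tendsto (fun γ => ‖f γ‖) l (𝓝 ‖φ‖) := by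
  rw [topOne, nhds_inf, tendsto_inf, nhds_induced (fun φ : StrongDual ℝ (StrongDual ℝ E) => ‖φ‖),
    tendsto_comap_iff]
  rfl

theorem tendsto_topOne_of_tendsto_topCLB {Γ : Type*} {l : Filter Γ}
    {f : Γ → StrongDual ℝ (StrongDual ℝ E)} {φ : StrongDual ℝ (StrongDual ℝ E)}
    (hf : Tendsto f l (@nhds _ (topCLB E) φ)) : Tendsto f l (@nhds _ (topOne E) φ) := by
  rw [tendsto_topCLB_iff] at hf
  rw [tendsto_topOne_iff, tendsto_topWeakStar_iff]
  refine ⟨fun v => ?_, ?_⟩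
  · simpa only [biconj_dual, EReal.tendsto_coe] using hf v (isCLB_dual v)
  · simpa only [biconj_norm, EReal.tendsto_coe] using hf _ isCLB_norm

variable {A : Set (E × StrongDual ℝ E)}

theorem IsTypeED.isDenseType (hA : IsTypeED A) : IsDenseType A := by
  refine ⟨hA.1, fun y hy => ?_⟩
  obtain ⟨Γ, _, _, _, a, haA, ha⟩ := hA.2 y hy
  rw [tendsto_topNormProd_iff] at ha
  have h2 := tendsto_topOne_of_tendsto_topCLB ha.2
  have hb1 := (tendsto_topOne_iff.1 h2).2.eventually_lt_const (lt_add_one ‖y.2‖)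
  have hb2 := ha.1.norm.eventually_lt_const (lt_add_one ‖y.1‖)
  obtain ⟨γ₀, hγ₀⟩ := eventually_atTop.1 (hb1.and hb2)
  have hdir : IsDirectedOrder (Set.Ici γ₀) := by
    refine ⟨fun b c => ?_⟩
    obtain ⟨d, hd1, hd2⟩ := exists_ge_ge b.1 c.1
    exact ⟨⟨d, le_trans b.2 hd1⟩, hd1, hd2⟩
  have hval : Tendsto (Subtype.val : Set.Ici γ₀ → Γ) atTop atTop := by
    refine tendsto_atTop_atTop.2 fun b => ?_
    obtain ⟨c, hc1, hc2⟩ := exists_ge_ge γ₀ b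
    exact ⟨⟨c, hc1⟩, fun d hd => hc2.trans hd⟩
  -- Only a tail of the net is bounded, so the index set is cut down to the indices above `γ₀`.
  refine ⟨Set.Ici γ₀, inferInstance, hdir, ⟨⟨γ₀, le_rfl⟩⟩, fun γ => a γ, fun γ => haA γ,
    ?_, ?_⟩
  · refine isBounded_iff_forall_norm_le.2 ⟨max (‖y.2‖ + 1) (‖y.1‖ + 1), ?_⟩
    rintro _ ⟨γ, rfl⟩
    have h3 := hγ₀ γ.1 γ.2
    have h4 : ‖NormedSpace.inclusionInDoubleDual ℝ E (a γ).1‖ = ‖(a γ).1‖ :=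
      (NormedSpace.inclusionInDoubleDualLi ℝ (E := E)).norm_map _
    rw [h4] at h3
    rw [Prod.norm_def]
    exact max_le_max h3.1.le h3.2.le
  · rw [tendsto_topNormProd_iff]
    exact ⟨ha.1.comp hval, h2.comp hval⟩

theorem IsDenseType.isTypeD (hA : IsDenseType A) : IsTypeD A := by
  refine ⟨hA.1, fun y hy => ?_⟩
  obtain ⟨Γ, i₁, i₂, i₃, a, haA, hab, ha⟩ := hA.2 y hy
  rw [tendsto_topNormProd_iff] at ha
  exact ⟨Γ, i₁, i₂, i₃, a, haA, hab,
    tendsto_topNormProd_iff.2 ⟨ha.1, (tendsto_topOne_iff.1 ha.2).1⟩⟩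

theorem IsTypeD.isTypeWD (hA : IsTypeD A) : IsTypeWD A := by
  refine ⟨hA.1, fun y hy => ?_⟩
  obtain ⟨Γ, i₁, i₂, i₃, a, haA, hab, ha⟩ := hA.2 y hy
  exact ⟨Γ, i₁, i₂, i₃, a, haA, hab, (tendsto_topNormProd_iff.1 ha).1⟩

theorem IsTypeWD.isTypeNI (hA : IsTypeWD A) : IsTypeNI A := by
  refine ⟨hA.1, fun y => ?_⟩
  by_contra! hpos
  obtain ⟨Γ, _, _, _, a, haA, hab, ha⟩ := hA.2 y hpos.le
  obtain ⟨M, hM⟩ := isBounded_iff_forall_norm_le.1 hab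
  have hlim : Tendsto (fun γ => (M + ‖y.2‖) * ‖(a γ).2 - y.1‖) atTop (𝓝 0) := by
    simpa using (tendsto_iff_norm_sub_tendsto_zero.1 ha).const_mul (M + ‖y.2‖)
  have hlim' := (continuous_coe_real_ereal.tendsto _).comp hlim
  -- A positive infimum places `y` in the extension, yet that infimum is below a quantity tending to
  -- `0` along the net.
  refine hpos.not_ge (ge_of_tendsto' hlim' fun γ => ?_)
  refine (iInf₂_le (a γ) (haA γ)).trans (EReal.coe_le_coe_iff.2 ?_)
  refine (le_abs_self _).trans ((ContinuousLinearMap.le_opNorm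
    (NormedSpace.inclusionInDoubleDual ℝ E (a γ).1 - y.2) ((a γ).2 - y.1)).trans ?_)
  beta_reduce
  gcongr
  refine (norm_sub_le _ _).trans (add_le_add ?_ le_rfl)
  exact (NormedSpace.double_dual_bound ℝ E _).trans ((norm_fst_le _).trans (hM _ ⟨γ, rfl⟩))

theorem IsTypeNI.isTypeED [CompleteSpace E] (hA : IsTypeNI A) : IsTypeED A := by
  classical
  refine ⟨hA.1, fun y hy => ?_⟩
  choose a haA ha1 ha2 using fun γ : Finset {h : E → ℝ // IsCLB h} × ℕ =>
    hA.exists_mem_approx hy γ.1 (Nat.one_div_pos_of_nat (α := ℝ) (n := γ.2))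
  have hlim : Tendsto (fun γ : Finset {h : E → ℝ // IsCLB h} × ℕ => 1 / ((γ.2 : ℝ) + 1))
      atTop (𝓝 0) := by
    rw [← prod_atTop_atTop_eq]
    exact tendsto_one_div_add_atTop_nhds_zero_nat.comp tendsto_snd
  -- An index is a finite family of test functions with a precision `1 / (n + 1)`; each `h` is
  -- controlled once the family contains it.
  refine ⟨Finset {h : E → ℝ // IsCLB h} × ℕ, inferInstance, inferInstance, inferInstance, a, haA,
    tendsto_topNormProd_iff.2 ⟨?_, tendsto_topCLB_iff.2 fun h hh => ?_⟩⟩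
  · exact tendsto_iff_norm_sub_tendsto_zero.2
      (squeeze_zero (fun _ => norm_nonneg _) (fun γ => (ha1 γ).le) hlim)
  · obtain ⟨t, ht⟩ := hh.exists_biconj_eq y.2
    simp only [biconj_inclusion hh, ht, EReal.tendsto_coe]
    refine tendsto_iff_dist_tendsto_zero.2 (squeeze_zero' (.of_forall fun _ => dist_nonneg) ?_ hlim)
    filter_upwards [eventually_ge_atTop ({⟨h, hh⟩}, 0)] with γ hγ
    have := ha2 γ ⟨h, hh⟩ (Finset.singleton_subset_iff.1 hγ.1)
    rw [ht, EReal.toReal_coe] at this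
    exact this.le

end Topology

end MonotoneClass

theorem theorem9p5 {E : Type*} [NormedAddCommGroup E] [NormedSpace ℝ E] [CompleteSpace E]
    [Nontrivial E] (A : Set (E × StrongDual ℝ E)) (hA : MonotoneClass.IsMaximallyMonotone A) :
    List.TFAE
      [MonotoneClass.IsTypeED A, MonotoneClass.IsDenseType A, MonotoneClass.IsTypeD A,
        MonotoneClass.IsTypeWD A, MonotoneClass.IsTypeNI A] := by
  tfae_have 1 → 2 := MonotoneClass.IsTypeED.isDenseType
  tfae_have 2 → 3 := MonotoneClass.IsDenseType.isTypeD
  tfae_have 3 → 4 := MonotoneClass.IsTypeD.isTypeWD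
  tfae_have 4 → 5 := MonotoneClass.IsTypeWD.isTypeNI
  tfae_have 5 → 1 := MonotoneClass.IsTypeNI.isTypeED
  tfae_finish
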